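/- **Setting.** Let $(\Omega,\mathcal G,\mathsf P)$ be a probability space with a right-continuous filtration $\mathbb F=(\mathcal F_t)_{t\ge 0}$ such that $\mathcal F_0$ contains all $\mathsf P$-null sets (and their subsets), and let $\mathcal F_\infty=\bigvee_{t\ge0}\mathcal F_t\subseteq\mathcal G$. Let $X$ be an $\mathbb R^d$-valued, $\mathbb F$-adapted, right-continuous, quasi-left-continuous strong Markov process with respect to $\mathbb F$, realised as a flow $(t,x)\mapsto X^x_t$ on $\Omega$ with $X^x_0=x$ $\mathsf P$-a.s.; $\mathsf E_x$ denotes expectation for the process started from $x$, i.e. with $X$ replaced by $X^x$ (under $\mathsf P$). Let $\vartheta\ge 0$ be a finite random variable, independent of $\mathcal F_\infty$, with distribution $F$. Let $r>0$, $p\in(0,1)$, and let $\varphi,\psi:\mathbb R^d\to[0,\infty)$ be Borel measurable with $\varphi\le\psi$. Let $\mathcal T$ be the set of $\mathbb F$-stopping times with values in $[0,\infty]$, and $$\mathcal D=\{(\tau,\alpha):\ \tau\in\mathcal T,\ \alpha\ \text{is } \{0,1\}\text{-valued and } \mathcal F_\tau\text{-measurable}\}.$$ We use the conventions $e^{-r\infty}=0$,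 $f(X_\infty)=\limsup_{t\to\infty}f(X_t)$ for Borel $f:\mathbb R^d\to[0,\infty]$, and $0\cdot\infty=0$. Expectations of non-negative quantities take values in $[0,\infty]$. **Problem 1.** Find a continuous $v:\mathbb R^d\to[0,\infty)$ such that, for all $x\in\mathbb R^d$, $$v(x)=\sup_{(\tau,\alpha)\in\mathcal D}\mathsf E_x\Big[e^{-r\tau}\varphi(X_\tau)1_{\{\alpha=0\}}+e^{-r(\tau+\vartheta)}\big(p\,\psi(X_{\tau+\vartheta})+(1-p)\,v(X_{\tau+\vartheta})\big)1_{\{\alpha=1\}}\Big].$$ **Problem 2.** Find a continuous $v:\mathbb R^d\to[0,\infty)$ such that, for all $x\in\mathbb R^d$, $$v(x)=\sup_{\tau\in\mathcal T}\mathsf E_x\Big[e^{-r\tau}\max\{\varphi(X_\tau),(\Lambda v)(X_\tau)\}\Big],$$ where $$(\Lambda f)(x):=\int_{[0,\infty)}e^{-rt}\,\mathsf E_x\big[p\,\psi(X_t)+(1-p)f(X_t)\big]\,F(\mathrm dt)\in[0,\infty].$$ **Lemma 2.4.** A continuous function $v:\mathbb R^d\to[0,\infty)$ is a solution of Problem 1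 if and only if it is a solution of Problem 2. Moreover, if $v$ solves Problem 2 and $\tau_*\in\mathcal T$ attains the supremum in Problem 2 for the starting point $x$, then, with $$\alpha^*:=1_{\{(\Lambda v)(X^x_{\tau_*})>\varphi(X^x_{\tau_*})\}},$$ the pair $(\tau_*,\alpha^*)$ belongs to $\mathcal D$ and attains the supremum in Problem 1 for the starting point $x$. -/

import Mathlib

open MeasureTheory ProbabilityTheory Filter Topology
open scoped NNReal ENNReal

namespace RecursiveStopping

noncomputable section

/-- The state space `ℝ^d` with its Euclidean norm. -/
abbrev State (d : ℕ) : Type := EuclideanSpace ℝ (Fin d)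

section Setting

variable {Ω : Type*} [m : MeasurableSpace Ω] {d : ℕ}

/-- The usual conditions: the filtration is right-continuous, and its initial σ-algebra contains
every `P`-null set (`P s = 0` for an arbitrary `s` means that `s` is contained in a measurable set
of measure zero). -/
structure UsualConditions (P : Measure Ω) (𝓕 : Filtration ℝ≥0 m) : Prop where
  rightContinuous : 𝓕.IsRightContinuous
  complete : ∀ s : Set Ω, P s = 0 → MeasurableSet[𝓕 0] s

/-- `X t x ω` is the value at time `t` of the path started from `x`. This says that
`(X^x)_{x ∈ ℝ^d}` is a right-continuous, quasi-left-continuous, strong Markov process with respect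
to `𝓕`, realised as a flow on `(Ω, P)`. The law of `X` under `P_y` is the law of the path
`X^y` under `P`, a measure on the path space `ℝ≥0 → ℝ^d` with its product σ-algebra. -/
structure IsStrongMarkovFlow (P : Measure Ω) (𝓕 : Filtration ℝ≥0 m)
    (X : ℝ≥0 → State d → Ω → State d) : Prop where
  /-- Each `X^x` is adapted. -/
  adapted : ∀ x, Adapted 𝓕 (fun t => X t x)
  /-- The paths are right-continuous. -/
  rightContinuous : ∀ x ω (t : ℝ≥0), ContinuousWithinAt (fun s => X s x ω) (Set.Ici t) t
  /-- `X^x_0 = x` almost surely. -/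
  initial : ∀ x, ∀ᵐ ω ∂P, X 0 x ω = x
  /-- `y ↦ P_y(X ∈ B)` is Borel measurable, for every measurable set `B` of paths. -/
  measurable_law : ∀ B : Set (ℝ≥0 → State d), MeasurableSet B →
    Measurable (fun y => P {ω | (fun t => X t y ω) ∈ B})
  /-- Strong Markov property: `P(X^x_{τ+·} ∈ B | 𝓕_τ) = P_y(X ∈ B)` at `y = X^x_τ`, almost surely
  on `{τ < ∞}`; the conditional probability is tested against the sets `A ∈ 𝓕_τ` with
  `A ⊆ {τ < ∞}`. -/
  strongMarkov : ∀ (x : State d) (τ : Ω → WithTop ℝ≥0) (hτ : IsStoppingTime 𝓕 τ)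
    (B : Set (ℝ≥0 → State d)), MeasurableSet B →
    ∀ A : Set Ω, MeasurableSet[hτ.measurableSpace] A → (∀ ω ∈ A, τ ω ≠ ⊤) →
      P (A ∩ {ω | (fun t => X ((τ ω).untopD 0 + t) x ω) ∈ B}) =
        ∫⁻ ω in A, P {ω' | (fun t => X t (X ((τ ω).untopD 0) x ω) ω') ∈ B} ∂P
  /-- Quasi-left-continuity: if the stopping times `σ n` increase to the stopping time `τ`, then
  `X^x_{σ n} → X^x_τ` almost surely on `{τ < ∞}`. -/
  quasiLeftContinuous : ∀ (x : State d) (σ : ℕ → Ω → WithTop ℝ≥0) (τ : Ω → WithTop ℝ≥0),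
    (∀ n, IsStoppingTime 𝓕 (σ n)) → IsStoppingTime 𝓕 τ →
    (∀ ω, Monotone (fun n => σ n ω)) → (∀ ω, IsLUB (Set.range (fun n => σ n ω)) (τ ω)) →
    ∀ᵐ ω ∂P, τ ω ≠ ⊤ →
      Tendsto (fun n => X ((σ n ω).untopD 0) x ω) atTop (𝓝 (X ((τ ω).untopD 0) x ω))

end Setting

section Problems

variable {Ω : Type*} [m : MeasurableSpace Ω] {d : ℕ}

/-- The discount factor `e^{-r t}` for `t ∈ [0, ∞]`, with `e^{-r ∞} = 0`. -/
def discount (r : ℝ) : WithTop ℝ≥0 → ℝ≥0∞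
  | ⊤ => 0
  | (t : ℝ≥0) => ENNReal.ofReal (Real.exp (-r * t))

/-- `f(X^x_t)` for `t ∈ [0, ∞]`, with the convention `f(X^x_∞) = limsup_{t → ∞} f(X^x_t)`. -/
def evalAt (X : ℝ≥0 → State d → Ω → State d) (f : State d → ℝ≥0∞) (x : State d) (ω : Ω) :
    WithTop ℝ≥0 → ℝ≥0∞
  | ⊤ => limsup (fun t : ℝ≥0 => f (X t x ω)) atTop
  | (t : ℝ≥0) => f (X t x ω)

/-- A function with values in `[0, ∞)`, viewed as a function with values in `[0, ∞]`. -/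
def ext (f : State d → ℝ≥0) : State d → ℝ≥0∞ := fun x => (f x : ℝ≥0∞)

/-- The admissible pairs: `τ` is a stopping time and `α`, with values in `{0, 1}`, is
`𝓕_τ`-measurable. -/
def Admissible (𝓕 : Filtration ℝ≥0 m) (τ : Ω → WithTop ℝ≥0) (α : Ω → Fin 2) : Prop :=
  ∃ hτ : IsStoppingTime 𝓕 τ, Measurable[hτ.measurableSpace] α

/-- The expected payoff of the pair `(τ, α)` started from `x`:
`E_x[e^{-rτ} φ(X_τ) 1_{α=0} + e^{-r(τ+ϑ)} (p ψ(X_{τ+ϑ}) + (1-p) v(X_{τ+ϑ})) 1_{α=1}]`. -/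
def payoff₁ (P : Measure Ω) (X : ℝ≥0 → State d → Ω → State d) (ϑ : Ω → ℝ≥0) (r p : ℝ)
    (φ ψ v : State d → ℝ≥0) (x : State d) (τ : Ω → WithTop ℝ≥0) (α : Ω → Fin 2) : ℝ≥0∞ :=
  ∫⁻ ω, ((if α ω = 0 then discount r (τ ω) * evalAt X (ext φ) x ω (τ ω) else 0) +
    (if α ω = 1 then discount r (τ ω + (ϑ ω : WithTop ℝ≥0)) *
      (ENNReal.ofReal p * evalAt X (ext ψ) x ω (τ ω + (ϑ ω : WithTop ℝ≥0)) +
        ENNReal.ofReal (1 - p) * evalAt X (ext v) x ω (τ ω + (ϑ ω : WithTop ℝ≥0))) else 0)) ∂P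

/-- The supremum of `payoff₁` over the admissible pairs. -/
def value₁ (P : Measure Ω) (𝓕 : Filtration ℝ≥0 m) (X : ℝ≥0 → State d → Ω → State d)
    (ϑ : Ω → ℝ≥0) (r p : ℝ) (φ ψ v : State d → ℝ≥0) (x : State d) : ℝ≥0∞ :=
  ⨆ (τ : Ω → WithTop ℝ≥0) (α : Ω → Fin 2) (_ : Admissible 𝓕 τ α),
    payoff₁ P X ϑ r p φ ψ v x τ α

/-- `v` is a solution of the recursive control/stopping problem. -/
def SolvesProblem₁ (P : Measure Ω) (𝓕 : Filtration ℝ≥0 m) (X : ℝ≥0 → State d → Ω → State d)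
    (ϑ : Ω → ℝ≥0) (r p : ℝ) (φ ψ v : State d → ℝ≥0) : Prop :=
  Continuous v ∧ ∀ x, (v x : ℝ≥0∞) = value₁ P 𝓕 X ϑ r p φ ψ v x

/-- `(τ, α)` is admissible and attains the supremum in the control/stopping problem started
from `x`. -/
def IsOptimalPair (P : Measure Ω) (𝓕 : Filtration ℝ≥0 m) (X : ℝ≥0 → State d → Ω → State d)
    (ϑ : Ω → ℝ≥0) (r p : ℝ) (φ ψ v : State d → ℝ≥0) (x : State d)
    (τ : Ω → WithTop ℝ≥0) (α : Ω → Fin 2) : Prop :=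
  Admissible 𝓕 τ α ∧ payoff₁ P X ϑ r p φ ψ v x τ α = value₁ P 𝓕 X ϑ r p φ ψ v x

/-- `(Λ f)(x) = ∫_{[0,∞)} e^{-rt} E_x[p ψ(X_t) + (1-p) f(X_t)] F(dt)`, where `F` is the
distribution of `ϑ`. -/
def Lam (P : Measure Ω) (X : ℝ≥0 → State d → Ω → State d) (ϑ : Ω → ℝ≥0) (r p : ℝ)
    (ψ f : State d → ℝ≥0) (x : State d) : ℝ≥0∞ :=
  ∫⁻ t : ℝ≥0, ENNReal.ofReal (Real.exp (-r * t)) *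
    (∫⁻ ω, (ENNReal.ofReal p * ext ψ (X t x ω) +
      ENNReal.ofReal (1 - p) * ext f (X t x ω)) ∂P) ∂(P.map ϑ)

/-- The expected payoff of the stopping time `τ` started from `x`:
`E_x[e^{-rτ} max {φ(X_τ), (Λ v)(X_τ)}]`. -/
def payoff₂ (P : Measure Ω) (X : ℝ≥0 → State d → Ω → State d) (ϑ : Ω → ℝ≥0) (r p : ℝ)
    (φ ψ v : State d → ℝ≥0) (x : State d) (τ : Ω → WithTop ℝ≥0) : ℝ≥0∞ :=
  ∫⁻ ω, discount r (τ ω) *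
    max (evalAt X (ext φ) x ω (τ ω)) (evalAt X (Lam P X ϑ r p ψ v) x ω (τ ω)) ∂P

/-- The supremum of `payoff₂` over the stopping times. -/
def value₂ (P : Measure Ω) (𝓕 : Filtration ℝ≥0 m) (X : ℝ≥0 → State d → Ω → State d)
    (ϑ : Ω → ℝ≥0) (r p : ℝ) (φ ψ v : State d → ℝ≥0) (x : State d) : ℝ≥0∞ :=
  ⨆ (τ : Ω → WithTop ℝ≥0) (_ : IsStoppingTime 𝓕 τ), payoff₂ P X ϑ r p φ ψ v x τ

/-- `v` is a solution of the recursive problem of stopping only. -/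
def SolvesProblem₂ (P : Measure Ω) (𝓕 : Filtration ℝ≥0 m) (X : ℝ≥0 → State d → Ω → State d)
    (ϑ : Ω → ℝ≥0) (r p : ℝ) (φ ψ v : State d → ℝ≥0) : Prop :=
  Continuous v ∧ ∀ x, (v x : ℝ≥0∞) = value₂ P 𝓕 X ϑ r p φ ψ v x

/-- `τ` is a stopping time that attains the supremum in the stopping problem started from `x`. -/
def IsOptimalTime (P : Measure Ω) (𝓕 : Filtration ℝ≥0 m) (X : ℝ≥0 → State d → Ω → State d)
    (ϑ : Ω → ℝ≥0) (r p : ℝ) (φ ψ v : State d → ℝ≥0) (x : State d)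
    (τ : Ω → WithTop ℝ≥0) : Prop :=
  IsStoppingTime 𝓕 τ ∧ payoff₂ P X ϑ r p φ ψ v x τ = value₂ P 𝓕 X ϑ r p φ ψ v x

open scoped Classical in
/-- The control `1_{(Λ v)(X_τ) > φ(X_τ)}` for the starting point `x`. -/
def alphaStar (P : Measure Ω) (X : ℝ≥0 → State d → Ω → State d) (ϑ : Ω → ℝ≥0) (r p : ℝ)
    (φ ψ v : State d → ℝ≥0) (x : State d) (τ : Ω → WithTop ℝ≥0) : Ω → Fin 2 := fun ω =>
  if evalAt X (Lam P X ϑ r p ψ v) x ω (τ ω) > evalAt X (ext φ) x ω (τ ω) then 1 else 0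

end Problems

end

end RecursiveStopping

/-! For a fixed continuous `v` the two suprema coincide at every starting point, so the two
fixed-point equations are the same. On `{α = 1, τ < ∞}`, the strong Markov property at `τ` and the
independence of `ϑ` from `𝓕_∞` turn the expected delayed reward into that of `e^{-rτ} (Λ v)(X_τ)`;
on `{τ = ∞}` the discount makes both vanish (`payoff₁_eq_lintegral_Lam`). The control then only
chooses between `φ(X_τ)` and `(Λ v)(X_τ)`, so the maximum bounds every pair and `alphaStar` attains
it pathwise.

The work lies in measurability. Replacing the delay by `Λ v` needs `E_y[g(X_t)]` to be jointly
measurable in `(t, y)` (`measurable_map_apply`). Admissibility of `alphaStar` needs `f(X_τ)` to be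
`𝓕_τ`-measurable also at `τ = ∞`, where it is an upper limit over uncountably many times of a merely
Borel function of the path. Measurable projection and the completeness of the filtration settle this
(`measurable_limsup_comp`), which is the reason for the analytic sets. -/

namespace RecursiveStopping

/-! ### Analytic sets are universally measurable. -/

section Analytic

theorem isCompact_box (n : ℕ → ℕ) : IsCompact {σ : ℕ → ℕ | ∀ i, σ i ≤ n i} := by
  convert isCompact_univ_pi (fun i => (Set.finite_Iic (n i)).isCompact) using 1
  ext σ; simp [Pi.le_def]

/-- An open set of sequences that contains the compact box `{σ | ∀ i, σ i ≤ n i}` contains one of the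
cylinders `{σ | ∀ i < k, σ i ≤ n i}`. -/
theorem exists_cylinder_subset_of_box_subset {n : ℕ → ℕ} {W : Set (ℕ → ℕ)} (hW : IsOpen W)
    (hn : {σ : ℕ → ℕ | ∀ i, σ i ≤ n i} ⊆ W) :
    ∃ k, {σ : ℕ → ℕ | ∀ i < k, σ i ≤ n i} ⊆ W := by
  by_contra! h
  simp only [Set.not_subset] at h
  choose σ hσ hσW using h
  have hK := isCompact_box n
  -- Truncation moves `σ k` into the compact box and leaves its coordinates below `k` unchanged, so
  -- both sequences have the same limits.
  obtain ⟨ρ, hρ, ψ, hψ, hlim⟩ := hK.tendsto_subseq (x := fun k i => min (σ k i) (n i))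
    (fun k i => min_le_right _ _)
  have hlim' : Tendsto (fun j => σ (ψ j)) atTop (𝓝 ρ) := by
    rw [tendsto_pi_nhds] at hlim ⊢
    intro i
    refine (hlim i).congr' ?_
    filter_upwards [eventually_gt_atTop i] with j hj
    exact min_eq_left (hσ _ i (hj.trans_le (hψ.id_le j)))
  obtain ⟨j, hj⟩ := (hlim'.eventually (hW.mem_nhds (hn hρ))).exists
  exact hσW _ hj

variable {α : Type*} [TopologicalSpace α] [TopologicalSpace.MetrizableSpace α]
  [MeasurableSpace α] [BorelSpace α]

/-- Inner regularity of the outer measure on the range of a continuous map on the Baire space. -/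
theorem exists_isCompact_subset_range_measure_ge (μ : Measure α) [IsFiniteMeasure μ]
    {f : (ℕ → ℕ) → α} (hf : Continuous f) {c : ℝ≥0∞} (hc : c < μ (Set.range f)) :
    ∃ K ⊆ Set.range f, IsCompact K ∧ c ≤ μ K := by
  -- Coordinates are bounded one at a time; continuity from below holds for outer measure, so the
  -- images need not be measurable.
  have step : ∀ (k : ℕ) (C : {C : Set (ℕ → ℕ) // c < μ (f '' C)}),
      ∃ m : ℕ, c < μ (f '' (C.1 ∩ {σ | σ k ≤ m})) := by
    rintro k ⟨C, hC⟩
    have hU : f '' C = ⋃ m : ℕ, f '' (C ∩ {σ | σ k ≤ m}) := by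
      rw [← Set.image_iUnion, ← Set.inter_iUnion]
      congr 1
      refine (Set.inter_eq_left.2 fun σ _ => Set.mem_iUnion.2 ⟨σ k, ?_⟩).symm
      simp
    have hmono : Monotone fun m : ℕ => f '' (C ∩ {σ | σ k ≤ m}) := by
      intro a b hab
      refine Set.image_mono (Set.inter_subset_inter_right _ fun σ (hσ : σ k ≤ a) => ?_)
      exact hσ.trans hab
    rw [hU, hmono.measure_iUnion] at hC
    exact lt_iSup_iff.1 hC
  choose b hb using step
  let S : ℕ → {C : Set (ℕ → ℕ) // c < μ (f '' C)} := fun k =>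
    Nat.rec ⟨Set.univ, by rwa [Set.image_univ]⟩ (fun k C => ⟨C.1 ∩ {σ | σ k ≤ b k C}, hb k C⟩) k
  let n : ℕ → ℕ := fun k => b k (S k)
  have hS : ∀ k, (S k).1 = {σ | ∀ i < k, σ i ≤ n i} := by
    intro k
    induction k with
    | zero => ext σ; simp [S]
    | succ k ih =>
      have : (S (k + 1)).1 = (S k).1 ∩ {σ | σ k ≤ n k} := rfl
      rw [this, ih]
      ext σ
      exact ⟨fun h i hi => (Nat.lt_succ_iff_lt_or_eq.1 hi).elim (h.1 i) fun e => e ▸ h.2,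
        fun h => ⟨fun i hi => h i (hi.trans k.lt_succ_self), h k k.lt_succ_self⟩⟩
  have hK := isCompact_box n
  refine ⟨f '' {σ | ∀ i, σ i ≤ n i}, Set.image_subset_range _ _, hK.image hf, ?_⟩
  -- Continuity from above may fail for these images, so the bound passes to the compact set through
  -- its open supersets, each of which contains the image of some `S k`.
  rw [Set.measure_eq_iInf_isOpen]
  refine le_iInf₂ fun U hU => le_iInf fun hUo => ?_
  obtain ⟨k, hk⟩ := exists_cylinder_subset_of_box_subset (hUo.preimage hf) (Set.image_subset_iff.1 hU)
  have := (S k).2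
  rw [hS k] at this
  exact this.le.trans (measure_mono (Set.image_subset_iff.2 hk))

/-- Analytic sets are universally measurable. -/
theorem nullMeasurableSet_of_analyticSet (μ : Measure α) [IsFiniteMeasure μ] {s : Set α}
    (hs : AnalyticSet s) : NullMeasurableSet s μ := by
  rw [AnalyticSet] at hs
  rcases hs with rfl | ⟨f, hf, rfl⟩
  · exact nullMeasurableSet_empty
  by_cases h0 : μ (Set.range f) = 0
  · exact NullMeasurableSet.of_null h0
  obtain ⟨c, -, hc, hlim⟩ := exists_seq_strictMono_tendsto' (pos_iff_ne_zero.2 h0)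
  choose K hKs hK hcK using fun j => exists_isCompact_subset_range_measure_ge μ hf (hc j).2
  have hB : MeasurableSet (⋃ j, K j) := .iUnion fun j => (hK j).isClosed.measurableSet
  have hle : μ (Set.range f) ≤ μ (⋃ j, K j) :=
    le_of_tendsto' hlim fun j => (hcK j).trans (measure_mono (Set.subset_iUnion _ j))
  exact hB.nullMeasurableSet.congr
    (ae_eq_of_subset_of_measure_ge (Set.iUnion_subset hKs) hle hB.nullMeasurableSet
      (measure_ne_top _ _))

end Analytic

/-! ### Joint and progressive measurability of right-continuous processes. -/

section RightContinuous

/-- The smallest multiple of `1 / (n + 1)` above `t`. -/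
noncomputable def gridAbove (n : ℕ) (t : ℝ≥0) : ℝ≥0 := (⌊t * (n + 1)⌋₊ + 1) / (n + 1)

theorem le_gridAbove (n : ℕ) (t : ℝ≥0) : t ≤ gridAbove n t := by
  rw [gridAbove, le_div_iff₀ (by positivity)]
  exact (Nat.lt_floor_add_one _).le

theorem gridAbove_le (n : ℕ) (t : ℝ≥0) : gridAbove n t ≤ t + 1 / ((n : ℝ≥0) + 1) := by
  have h := Nat.floor_le (zero_le (a := t * ((n : ℝ≥0) + 1)))
  rw [gridAbove, add_div]
  gcongr
  rwa [div_le_iff₀ (by positivity)]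

theorem tendsto_gridAbove (t : ℝ≥0) :
    Tendsto (fun n => gridAbove n t) atTop (𝓝[Set.Ici t] t) := by
  refine tendsto_nhdsWithin_iff.2 ⟨?_, .of_forall fun n => le_gridAbove n t⟩
  refine tendsto_of_tendsto_of_tendsto_of_le_of_le tendsto_const_nhds ?_
    (fun n => le_gridAbove n t) (fun n => gridAbove_le n t)
  simpa using (tendsto_const_nhds (x := t)).add (tendsto_one_div_add_atTop_nhds_zero_nat (𝕜 := ℝ≥0))

/-- A right-continuous process whose marginals are measurable is jointly measurable. -/
theorem measurable_uncurry_of_rightContinuous {S β : Type*} [MeasurableSpace S]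
    [TopologicalSpace β] [TopologicalSpace.PseudoMetrizableSpace β] [MeasurableSpace β]
    [BorelSpace β] {u : ℝ≥0 → S → β} (hu : ∀ t, Measurable (u t))
    (hc : ∀ s t, ContinuousWithinAt (fun t => u t s) (Set.Ici t) t) :
    Measurable (fun q : ℝ≥0 × S => u q.1 q.2) := by
  have hlim : Tendsto (fun n (q : ℝ≥0 × S) => u (gridAbove n q.1) q.2) atTop
      (𝓝 fun q : ℝ≥0 × S => u q.1 q.2) :=
    tendsto_pi_nhds.2 fun q => (hc q.2 q.1).tendsto.comp (tendsto_gridAbove q.1)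
  refine measurable_of_tendsto_metrizable (fun n => ?_) hlim
  -- For fixed `n` only countably many times occur, so measurable marginals suffice.
  have h : Measurable fun q : ℕ × S => u (((q.1 : ℝ≥0) + 1) / (n + 1)) q.2 :=
    measurable_from_prod_countable_right (f := fun q : ℕ × S => u (((q.1 : ℝ≥0) + 1) / (n + 1)) q.2)
      fun k => hu (((k : ℝ≥0) + 1) / (n + 1))
  have hfloor : Measurable fun t : ℝ≥0 => ⌊t * (n + 1)⌋₊ :=
    Nat.measurable_floor.comp (measurable_id.mul_const ((n : ℝ≥0) + 1))
  exact h.comp (g := fun q : ℕ × S => u (((q.1 : ℝ≥0) + 1) / (n + 1)) q.2)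
    (f := fun q : ℝ≥0 × S => (⌊q.1 * (n + 1)⌋₊, q.2)) (hfloor.prodMap measurable_id)

/-- A right-continuous adapted process is progressive. -/
theorem isStronglyProgressive_of_rightContinuous {Ω β : Type*} {m : MeasurableSpace Ω}
    [TopologicalSpace β] [TopologicalSpace.PseudoMetrizableSpace β] [SecondCountableTopology β]
    [MeasurableSpace β] [BorelSpace β] {𝓕 : Filtration ℝ≥0 m} {u : ℝ≥0 → Ω → β}
    (hu : Adapted 𝓕 u) (hc : ∀ ω t, ContinuousWithinAt (fun t => u t ω) (Set.Ici t) t) :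
    IsStronglyProgressive 𝓕 u := by
  refine IsProgressive.isStronglyProgressive fun i => ?_
  -- Freezing the process at time `i` keeps it right-continuous and makes all its marginals `𝓕
  -- i`-measurable.
  have h := @measurable_uncurry_of_rightContinuous Ω β (𝓕 i) _ _ _ _ (fun t => u (min t i))
    (fun t => (hu _).mono (𝓕.mono (min_le_right _ _)) le_rfl)
    (fun ω t => (hc ω (min t i)).comp (f := fun t => min t i)
      (by fun_prop) (fun s (hs : t ≤ s) => min_le_min_right i hs))
  have h2 := h.comp (f := fun q : Set.Iic i × Ω => ((q.1 : ℝ≥0), q.2))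
    ((measurable_subtype_coe.comp measurable_fst).prodMk measurable_snd)
  convert! h2 using 2 with q
  exact congrArg (fun t => u t q.2) (min_eq_left (Set.mem_Iic.1 q.1.2)).symm

end RightContinuous

/-! ### Measurable projection and upper limits along paths. -/

section Projection

/-- This makes a measurable subset of `T × Ω` the preimage of a Borel subset of the Polish space `T
× E`, whose projection is analytic. -/
theorem comap_prodMap_id {T Ω E : Type*} [MeasurableSpace T] [mE : MeasurableSpace E] (Φ : Ω → E) :
    (inferInstance : MeasurableSpace (T × E)).comap (Prod.map id Φ) =
      @Prod.instMeasurableSpace T Ω _ (mE.comap Φ) := by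
  simp only [inferInstance, Prod.instMeasurableSpace, MeasurableSpace.prod,
    MeasurableSpace.comap_sup, MeasurableSpace.comap_comp]
  rfl

/-- Measurable projection, for a σ-algebra generated by a map to a Polish space. -/
theorem exists_nullMeasurableSet_image_snd {T Ω E : Type*} [TopologicalSpace T] [PolishSpace T]
    [MeasurableSpace T] [BorelSpace T] [TopologicalSpace E] [PolishSpace E]
    [mE : MeasurableSpace E] [BorelSpace E] (μ : Measure E) [IsFiniteMeasure μ] (Φ : Ω → E)
    {s : Set (T × Ω)} (hs : MeasurableSet[@Prod.instMeasurableSpace T Ω _ (mE.comap Φ)] s) :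
    ∃ A, NullMeasurableSet A μ ∧ Prod.snd '' s = Φ ⁻¹' A := by
  rw [← comap_prodMap_id] at hs
  obtain ⟨S, hS, rfl⟩ := hs
  refine ⟨Prod.snd '' S, nullMeasurableSet_of_analyticSet μ
    (hS.analyticSet.image_of_continuous continuous_snd), ?_⟩
  ext ω
  simp

variable {Ω : Type*} {β : Type*} [TopologicalSpace β] [PolishSpace β]
  [MeasurableSpace β] [BorelSpace β]

/-- The set of paths of a right-continuous process that meet a Borel set of times and states is
measurable with respect to any σ-algebra that measures the process and the null sets. -/
theorem measurableSet_exists_mem {𝓖 m : MeasurableSpace Ω} {P : Measure Ω} [IsFiniteMeasure P]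
    (h𝓖 : 𝓖 ≤ m) (hnull : ∀ s, P s = 0 → MeasurableSet[𝓖] s) {u : ℝ≥0 → Ω → β}
    (hu : ∀ t, Measurable[𝓖] (u t))
    (hc : ∀ ω t, ContinuousWithinAt (fun t => u t ω) (Set.Ici t) t)
    {B : Set (ℝ≥0 × β)} (hB : MeasurableSet B) :
    MeasurableSet[𝓖] {ω | ∃ t, (t, u t ω) ∈ B} := by
  -- These countably many times include all values of `gridAbove`, so by right-continuity `Φ`
  -- determines the whole path, while its target is Polish.
  let Φ : Ω → (ℕ × ℕ → β) := fun ω q => u ((q.1 + 1) / (q.2 + 1)) ω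
  have hΦ : Measurable[𝓖] Φ := @measurable_pi_lambda _ _ _ 𝓖 _ _ fun q => hu _
  have hΦm : Measurable Φ := hΦ.mono h𝓖 le_rfl
  have hu' : ∀ t, Measurable[MeasurableSpace.comap Φ inferInstance] (u t) := by
    intro t
    refine @measurable_of_tendsto_metrizable _ _ (MeasurableSpace.comap Φ inferInstance) _ _ _ _
      (fun n => u (gridAbove n t)) _ (fun n => ?_)
      (tendsto_pi_nhds.2 fun ω => (hc ω t).tendsto.comp (tendsto_gridAbove t))
    exact (measurable_pi_apply (⌊t * (n + 1)⌋₊, n)).comp (comap_measurable Φ)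
  have hjoint := @measurable_uncurry_of_rightContinuous Ω β (MeasurableSpace.comap Φ inferInstance)
    _ _ _ _ u hu' hc
  have hpair := (@measurable_fst ℝ≥0 Ω _ (MeasurableSpace.comap Φ inferInstance)).prodMk hjoint
  have hs := hpair hB
  obtain ⟨A, hA, hAs⟩ := exists_nullMeasurableSet_image_snd (P.map Φ) Φ hs
  have heq : {ω | ∃ t, (t, u t ω) ∈ B} = Φ ⁻¹' A := by
    rw [← hAs]; ext ω; simp
  rw [heq]
  obtain ⟨A', hA'm, hA'⟩ := hA
  have hae : Φ ⁻¹' A =ᵐ[P] Φ ⁻¹' A' := (hΦm.quasiMeasurePreserving P).preimage_ae_eq hA'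
  obtain ⟨h1, h2⟩ := ae_eq_set.1 hae
  -- The preimages of `A` and of the Borel set `A'` differ by null sets, which belong to `𝓖`.
  have := ((hΦ hA'm).union (hnull _ h1)).diff (hnull _ h2)
  convert this using 1
  ext ω
  simp only [Set.mem_sdiff, Set.mem_union]
  tauto

/-- The upper limit along the paths of a right-continuous process is measurable with respect to any
σ-algebra that measures the process and the null sets. -/
theorem measurable_limsup_comp {𝓖 m : MeasurableSpace Ω} {P : Measure Ω} [IsFiniteMeasure P]
    (h𝓖 : 𝓖 ≤ m) (hnull : ∀ s, P s = 0 → MeasurableSet[𝓖] s) {u : ℝ≥0 → Ω → β}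
    (hu : ∀ t, Measurable[𝓖] (u t))
    (hc : ∀ ω t, ContinuousWithinAt (fun t => u t ω) (Set.Ici t) t)
    {f : β → ℝ≥0∞} (hf : Measurable f) :
    Measurable[𝓖] fun ω => limsup (fun t => f (u t ω)) atTop := by
  have h : (fun ω => limsup (fun t => f (u t ω)) atTop) =
      fun ω => ⨅ n : ℕ, ⨆ t ∈ Set.Ici (n : ℝ≥0), f (u t ω) := by
    ext ω
    rw [(atTop_hasCountableBasis_of_archimedean (R := ℝ≥0)).toHasBasis.limsup_eq_iInf_iSup]
    simp
  rw [h]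
  refine @Measurable.iInf ℝ≥0∞ Ω _ _ _ 𝓖 _ _ _ _ _ _ fun n => ?_
  refine @measurable_of_Ioi ℝ≥0∞ Ω _ _ _ 𝓖 _ _ _ _ fun a => ?_
  -- The supremum exceeds `a` exactly when the path meets this set. Since `f` is only Borel, a
  -- countable set of times would not do.
  have hB : MeasurableSet {q : ℝ≥0 × β | (n : ℝ≥0) ≤ q.1 ∧ a < f q.2} :=
    (measurableSet_le measurable_const measurable_fst).inter
      (measurableSet_lt measurable_const (hf.comp measurable_snd))
  convert measurableSet_exists_mem h𝓖 hnull hu hc hB using 1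
  ext ω
  simp [lt_iSup_iff]

end Projection

/-- Independence makes the joint law a product, and Tonelli applies. It is used with `Z` the
identity into `Ω` carrying `⨆ t, 𝓕 t`, so that the integrand may depend on the whole path. -/
theorem lintegral_eq_lintegral_lintegral_of_indepFun {Ω S T : Type*} [MeasurableSpace S]
    [MeasurableSpace T] {m : MeasurableSpace Ω} {P : Measure Ω} [IsFiniteMeasure P] {ϑ : Ω → S}
    {Z : Ω → T} (hϑ : Measurable ϑ) (hZ : Measurable Z) (hind : IndepFun ϑ Z P)
    {G : S × T → ℝ≥0∞} (hG : Measurable G) :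
    ∫⁻ ω, G (ϑ ω, Z ω) ∂P = ∫⁻ s, ∫⁻ ω, G (s, Z ω) ∂P ∂(P.map ϑ) := by
  rw [← lintegral_map hG (hϑ.prodMk hZ),
    hind.map_prod_eq_prod_map_map hϑ.aemeasurable hZ.aemeasurable,
    lintegral_prod _ hG.aemeasurable]
  refine lintegral_congr fun s => ?_
  exact lintegral_map (hG.comp measurable_prodMk_left) hZ

/-- Two functions with the same integrals over the sets of a sub-σ-algebra inside `S` have the same
integrals over `S` against every weight that is measurable for the sub-σ-algebra. -/
theorem setLIntegral_mul_eq_of_forall_setLIntegral_eq {Ω : Type*} {𝓐 m : MeasurableSpace Ω}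
    {P : Measure Ω} (h𝓐 : 𝓐 ≤ m) {S : Set Ω} (hS : MeasurableSet[𝓐] S)
    {f₁ f₂ : Ω → ℝ≥0∞} (hf₁ : Measurable f₁) (hf₂ : Measurable f₂)
    (heq : ∀ A, MeasurableSet[𝓐] A → A ⊆ S → ∫⁻ ω in A, f₁ ω ∂P = ∫⁻ ω in A, f₂ ω ∂P)
    {h : Ω → ℝ≥0∞} (hh : Measurable[𝓐] h) :
    ∫⁻ ω in S, h ω * f₁ ω ∂P = ∫⁻ ω in S, h ω * f₂ ω ∂P := by
  -- The two densities define measures that agree on `𝓐`, and the integral of the `𝓐`-measurable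
  -- weight depends on nothing else.
  have key : ((P.restrict S).withDensity f₁).trim h𝓐 = ((P.restrict S).withDensity f₂).trim h𝓐 := by
    refine @Measure.ext _ 𝓐 _ _ fun A hA => ?_
    rw [trim_measurableSet_eq h𝓐 hA, trim_measurableSet_eq h𝓐 hA, withDensity_apply _ (h𝓐 _ hA),
      withDensity_apply _ (h𝓐 _ hA), Measure.restrict_restrict (h𝓐 _ hA)]
    exact heq _ (hA.inter hS) Set.inter_subset_right
  have aux : ∀ f, Measurable f → ∫⁻ ω in S, h ω * f ω ∂P =
      ∫⁻ ω, h ω ∂(((P.restrict S).withDensity f).trim h𝓐) := by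
    intro f hf
    rw [lintegral_trim h𝓐 hh, lintegral_withDensity_eq_lintegral_mul _ hf (hh.mono h𝓐 le_rfl)]
    simp [mul_comm]
  rw [aux f₁ hf₁, aux f₂ hf₂, key]

/-! ### The strong Markov property at an independent random time. -/

section Markov

variable {Ω : Type*} [m : MeasurableSpace Ω] {d : ℕ} {P : Measure Ω} {𝓕 : Filtration ℝ≥0 m}
  {X : ℝ≥0 → State d → Ω → State d}

namespace IsStrongMarkovFlow

theorem measurable_apply (hX : IsStrongMarkovFlow P 𝓕 X) (t : ℝ≥0) (x : State d) :
    Measurable (X t x) :=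
  (hX.adapted x t).mono (𝓕.le t) le_rfl

theorem measurable_uncurry_iSup (hX : IsStrongMarkovFlow P 𝓕 X) (x : State d) :
    Measurable[@Prod.instMeasurableSpace ℝ≥0 Ω _ (⨆ t, 𝓕 t)]
      (fun q : ℝ≥0 × Ω => X q.1 x q.2) :=
  @measurable_uncurry_of_rightContinuous Ω (State d) (⨆ t, 𝓕 t) _ _ _ _ (fun t => X t x)
    (fun t => (hX.adapted x t).mono (le_iSup 𝓕.seq t) le_rfl) (hX.rightContinuous x)

theorem measurable_uncurry (hX : IsStrongMarkovFlow P 𝓕 X) (x : State d) :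
    Measurable (fun q : ℝ≥0 × Ω => X q.1 x q.2) :=
  measurable_uncurry_of_rightContinuous (fun t => hX.measurable_apply t x) (hX.rightContinuous x)

/-- The law of `X_t` under `P_y` is a measurable function of the pair `(t, y)`. -/
theorem measurable_map_apply [IsProbabilityMeasure P] (hX : IsStrongMarkovFlow P 𝓕 X) :
    Measurable (fun q : ℝ≥0 × State d => P.map (X q.1 q.2)) := by
  have hprob : ∀ q : ℝ≥0 × State d, IsProbabilityMeasure (P.map (X q.1 q.2)) := fun q =>
    Measure.isProbabilityMeasure_map (hX.measurable_apply _ _).aemeasurable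
  have hmarg : ∀ t, Measurable fun y => P.map (X t y) := by
    refine fun t => Measure.measurable_of_measurable_coe _ fun B hB => ?_
    have := hX.measurable_law {w | w t ∈ B} (measurable_pi_apply t hB)
    convert this using 2 with y
    rw [Measure.map_apply (hX.measurable_apply _ _) hB]
    rfl
  -- For bounded continuous `f` the mean is right-continuous in `t` by dominated convergence, hence
  -- jointly measurable. Closed sets follow by approximating their indicators, and they form a
  -- generating π-system.
  have hcont : ∀ f : BoundedContinuousFunction (State d) ℝ≥0,
      Measurable fun q : ℝ≥0 × State d => ∫⁻ z, f z ∂(P.map (X q.1 q.2)) := by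
    intro f
    have hfc : Continuous fun z => (f z : ℝ≥0∞) := ENNReal.continuous_coe.comp f.continuous
    have hf : Measurable fun z => (f z : ℝ≥0∞) := hfc.measurable
    refine measurable_uncurry_of_rightContinuous (u := fun t y => ∫⁻ z, f z ∂(P.map (X t y)))
      (fun t => (Measure.measurable_lintegral hf).comp (hmarg t)) fun y t => ?_
    have heq : ∀ s, ∫⁻ z, f z ∂(P.map (X s y)) = ∫⁻ ω, f (X s y ω) ∂P := fun s =>
      lintegral_map hf (hX.measurable_apply _ _)
    simp only [ContinuousWithinAt, heq]
    refine tendsto_lintegral_filter_of_dominated_convergence (fun _ => (nndist f 0 : ℝ≥0∞))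
      (.of_forall fun s => hf.comp (hX.measurable_apply _ _))
      (.of_forall fun s => .of_forall fun ω => ?_) (by simp) (.of_forall fun ω => ?_)
    · exact ENNReal.coe_le_coe.2 (BoundedContinuousFunction.NNReal.upper_bound f _)
    · exact (hfc.tendsto (X t y ω)).comp
        (hX.rightContinuous y ω t).tendsto
  have hgen := (BorelSpace.measurable_eq (α := State d)).trans borel_eq_generateFrom_isClosed
  refine Measurable.measure_of_isPiSystem_of_isProbabilityMeasure hgen isPiSystem_isClosed
    fun F hF => ?_
  refine measurable_of_tendsto_metrizable
    (fun n => hcont (thickenedIndicator (Nat.one_div_pos_of_nat (n := n)) F))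
    (tendsto_pi_nhds.2 fun q => ?_)
  exact tendsto_lintegral_thickenedIndicator_of_isClosed _ hF _
    tendsto_one_div_add_atTop_nhds_zero_nat

theorem measurable_lintegral_apply [IsProbabilityMeasure P] (hX : IsStrongMarkovFlow P 𝓕 X)
    {g : State d → ℝ≥0∞} (hg : Measurable g) :
    Measurable (fun q : ℝ≥0 × State d => ∫⁻ ω, g (X q.1 q.2 ω) ∂P) := by
  have h := (Measure.measurable_lintegral hg).comp hX.measurable_map_apply
  convert h using 2 with q
  exact (lintegral_map hg (hX.measurable_apply _ _)).symm

variable {τ : Ω → WithTop ℝ≥0}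

theorem measurable_shift (hX : IsStrongMarkovFlow P 𝓕 X) (hτ : IsStoppingTime 𝓕 τ) (x : State d)
    (t : ℝ≥0) : Measurable fun ω => X ((τ ω).untopD 0 + t) x ω :=
  (hX.measurable_uncurry x).comp
    (((hτ.measurable'.untopD 0).add_const t).prodMk measurable_id)

/-- The strong Markov property at a fixed time after `τ`, for expectations. -/
theorem setLIntegral_shift [IsProbabilityMeasure P] (hX : IsStrongMarkovFlow P 𝓕 X)
    (hτ : IsStoppingTime 𝓕 τ) (x : State d) (t : ℝ≥0) {A : Set Ω}
    (hA : MeasurableSet[hτ.measurableSpace] A) (hAτ : ∀ ω ∈ A, τ ω ≠ ⊤) {g : State d → ℝ≥0∞}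
    (hg : Measurable g) :
    ∫⁻ ω in A, g (X ((τ ω).untopD 0 + t) x ω) ∂P =
      ∫⁻ ω in A, ∫⁻ ω', g (X t (X ((τ ω).untopD 0) x ω) ω') ∂P ∂P := by
  have hY := hX.measurable_shift hτ x t
  have hY0 : Measurable fun ω => X ((τ ω).untopD 0) x ω := by simpa using hX.measurable_shift hτ x 0
  have hκ : Measurable fun ω => P.map (X t (X ((τ ω).untopD 0) x ω)) :=
    hX.measurable_map_apply.comp (measurable_const.prodMk hY0)
  have key : (P.restrict A).map (fun ω => X ((τ ω).untopD 0 + t) x ω) =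
      (P.restrict A).bind fun ω => P.map (X t (X ((τ ω).untopD 0) x ω)) := by
    ext B hB
    rw [Measure.map_apply hY hB, Measure.restrict_apply (hY hB),
      Measure.bind_apply hB hκ.aemeasurable, Set.inter_comm]
    refine (hX.strongMarkov x τ hτ {w | w t ∈ B} (measurable_pi_apply t hB) A hA hAτ).trans
      (lintegral_congr fun ω => ?_)
    rw [Measure.map_apply (hX.measurable_apply _ _) hB]
    rfl
  rw [← lintegral_map hg hY, key, Measure.lintegral_bind hκ.aemeasurable hg.aemeasurable]
  exact lintegral_congr fun ω => lintegral_map hg (hX.measurable_apply _ _)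

/-- The strong Markov property at an independent random time after `τ`. -/
theorem lintegral_mul_shift_of_indep [IsProbabilityMeasure P] (hX : IsStrongMarkovFlow P 𝓕 X)
    {ϑ : Ω → ℝ≥0} (hϑ : Measurable ϑ)
    (hindep : Indep (MeasurableSpace.comap ϑ inferInstance) (⨆ t, 𝓕 t) P)
    (hτ : IsStoppingTime 𝓕 τ) (x : State d) {h : Ω → ℝ≥0∞}
    (hh : Measurable[hτ.measurableSpace] h) (hhτ : ∀ ω, τ ω = ⊤ → h ω = 0)
    {e : ℝ≥0 → ℝ≥0∞} (he : Measurable e) {g : State d → ℝ≥0∞} (hg : Measurable g) :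
    ∫⁻ ω, h ω * (e (ϑ ω) * g (X ((τ ω).untopD 0 + ϑ ω) x ω)) ∂P =
      ∫⁻ ω, h ω * ∫⁻ t, e t * ∫⁻ ω', g (X t (X ((τ ω).untopD 0) x ω) ω') ∂P ∂(P.map ϑ) ∂P := by
  have hle : (⨆ t, 𝓕 t) ≤ m := iSup_le 𝓕.le
  -- Measurability for `m` would not suffice: `ϑ` is independent only of `⨆ t, 𝓕 t`.
  have hG : Measurable[@Prod.instMeasurableSpace ℝ≥0 Ω _ (⨆ t, 𝓕 t)]
      fun q : ℝ≥0 × Ω => h q.2 * (e q.1 * g (X ((τ q.2).untopD 0 + q.1) x q.2)) := by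
    have hh' : Measurable[⨆ t, 𝓕 t] h := hh.mono hτ.measurableSpace_le' le_rfl
    have hτ' : Measurable[⨆ t, 𝓕 t] τ := hτ.measurable_iSup
    have hX' := hX.measurable_uncurry_iSup x
    let _ : MeasurableSpace Ω := ⨆ t, 𝓕 t
    exact (hh'.comp measurable_snd).mul ((he.comp measurable_fst).mul (hg.comp
      (hX'.comp
        ((((hτ'.untopD 0).comp measurable_snd).add measurable_fst).prodMk measurable_snd))))
  have hind : @IndepFun Ω ℝ≥0 Ω m _ (⨆ t, 𝓕 t) ϑ id P :=
    (@IndepFun_iff_Indep Ω ℝ≥0 Ω m _ (⨆ t, 𝓕 t) ϑ id P).2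
      (by rw [MeasurableSpace.comap_id]; exact hindep)
  have hstep := @lintegral_eq_lintegral_lintegral_of_indepFun Ω ℝ≥0 Ω _ (⨆ t, 𝓕 t) m P _ ϑ id hϑ
    (measurable_id'' hle) hind _ hG
  have hY0 : Measurable fun ω => X ((τ ω).untopD 0) x ω := by simpa using hX.measurable_shift hτ x 0
  have hhm : Measurable h := hh.mono hτ.measurableSpace_le le_rfl
  have hq : Measurable fun z : ℝ≥0 × Ω => ∫⁻ ω', g (X z.1 (X ((τ z.2).untopD 0) x z.2) ω') ∂P :=
    (hX.measurable_lintegral_apply hg).comp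
      (measurable_fst.prodMk (hY0.comp measurable_snd))
  have hS : MeasurableSet[hτ.measurableSpace] {ω | τ ω ≠ ⊤} :=
    (hτ.measurable (measurableSet_singleton ⊤)).compl
  -- On `{τ = ∞}` the time `untopD 0` is a dummy value and the strong Markov property is silent, but
  -- the weight vanishes there.
  have hrestrict : ∀ f : Ω → ℝ≥0∞, ∫⁻ ω, h ω * f ω ∂P = ∫⁻ ω in {ω | τ ω ≠ ⊤}, h ω * f ω ∂P := by
    intro f
    rw [← lintegral_indicator (hτ.measurableSpace_le _ hS)]
    refine lintegral_congr fun ω => ?_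
    by_cases hω : τ ω = ⊤ <;> simp [hω, hhτ]
  refine hstep.trans ?_
  have hmarkov : ∀ t, ∫⁻ ω, h ω * (e t * g (X ((τ ω).untopD 0 + t) x ω)) ∂P =
      ∫⁻ ω, h ω * (e t * ∫⁻ ω', g (X t (X ((τ ω).untopD 0) x ω) ω') ∂P) ∂P := by
    intro t
    have h1 := (hg.comp (hX.measurable_shift hτ x t))
    have h2 := hq.comp (measurable_prodMk_left (x := t))
    rw [hrestrict, hrestrict]
    refine setLIntegral_mul_eq_of_forall_setLIntegral_eq hτ.measurableSpace_le hS
      (h1.const_mul _) (h2.const_mul _) (fun A hA hAS => ?_) hh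
    rw [lintegral_const_mul _ h1, lintegral_const_mul _ h2]
    exact congrArg _ (hX.setLIntegral_shift hτ x t hA hAS hg)
  simp only [id, hmarkov]
  rw [lintegral_lintegral_swap]
  · refine lintegral_congr fun ω => lintegral_const_mul _ ?_
    exact he.mul (hq.comp measurable_prodMk_right)
  · exact ((hhm.comp measurable_snd).mul ((he.comp measurable_fst).mul hq)).aemeasurable

end IsStrongMarkovFlow

end Markov

/-! ### Comparison of the two payoffs. -/

section Payoff

variable {Ω : Type*} [m : MeasurableSpace Ω] {d : ℕ} {P : Measure Ω} {𝓕 : Filtration ℝ≥0 m}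
  {X : ℝ≥0 → State d → Ω → State d}

@[simp]
theorem discount_top (r : ℝ) : discount r ⊤ = 0 := rfl

theorem discount_coe (r : ℝ) (t : ℝ≥0) :
    discount r (t : WithTop ℝ≥0) = ENNReal.ofReal (Real.exp (-r * t)) := rfl

theorem discount_coe_add (r : ℝ) (s t : ℝ≥0) :
    discount r ((s : WithTop ℝ≥0) + t) = discount r s * ENNReal.ofReal (Real.exp (-r * t)) := by
  rw [← WithTop.coe_add, discount_coe, discount_coe, ← ENNReal.ofReal_mul (Real.exp_nonneg _),
    ← Real.exp_add, NNReal.coe_add, mul_add]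

theorem measurable_discount (r : ℝ) : Measurable (discount r) := by
  have h : discount r = fun t => if t = ⊤ then 0 else
      ENNReal.ofReal (Real.exp (-r * (t.untopD 0 : ℝ≥0))) := by
    ext t
    cases t with
    | top => simp
    | coe t => simp [discount_coe, -ENNReal.some_eq_coe, -ENNReal.some_eq_coe']
  rw [h]
  refine Measurable.ite (measurableSet_singleton ⊤) measurable_const ?_
  have h2 : Measurable fun t : WithTop ℝ≥0 => t.untopD 0 := measurable_id.untopD 0
  fun_prop

variable {τ : Ω → WithTop ℝ≥0}

/-- `f(X_τ)` is `𝓕_τ`-measurable, also on `{τ = ∞}`, where it is an upper limit. -/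
theorem measurable_evalAt [IsFiniteMeasure P] (h𝓕 : UsualConditions P 𝓕)
    (hX : IsStrongMarkovFlow P 𝓕 X) (hτ : IsStoppingTime 𝓕 τ) (x : State d)
    {f : State d → ℝ≥0∞} (hf : Measurable f) :
    Measurable[hτ.measurableSpace] fun ω => evalAt X f x ω (τ ω) := by
  have hlim : Measurable[⨆ t, 𝓕 t] fun ω => limsup (fun t => f (X t x ω)) atTop :=
    measurable_limsup_comp (iSup_le 𝓕.le)
      (fun s hs => le_iSup 𝓕.seq 0 _ (h𝓕.complete s hs))
      (fun t => (hX.adapted x t).mono (le_iSup 𝓕.seq t) le_rfl) (hX.rightContinuous x) hf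
  have hval := measurable_stoppedValue
    (isStronglyProgressive_of_rightContinuous (hX.adapted x) (hX.rightContinuous x)) hτ
  intro B hB
  have htop : MeasurableSet[hτ.measurableSpace] {ω | τ ω = ⊤} :=
    hτ.measurable (measurableSet_singleton ⊤)
  -- A subset of `{τ = ∞}` never meets `{τ ≤ i}`, so it lies in `𝓕_τ` as soon as it lies in `𝓕_∞`.
  have h1 : MeasurableSet[hτ.measurableSpace]
      ((fun ω => limsup (fun t => f (X t x ω)) atTop) ⁻¹' B ∩ {ω | τ ω = ⊤}) := by
    refine (hτ.measurableSet _).2 ⟨(hlim hB).inter hτ.measurableSet_eq_top', fun i => ?_⟩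
    convert @MeasurableSet.empty Ω (𝓕 i)
    ext ω
    simp +contextual [-ENNReal.some_eq_coe, -ENNReal.some_eq_coe']
  have h2 := (hval (hf hB)).inter htop.compl
  convert h1.union h2 using 1
  ext ω
  by_cases hω : τ ω = ⊤
  · simp [hω, evalAt]
  · lift τ ω to ℝ≥0 using hω with t ht
    simp [← ht, evalAt, stoppedValue, -ENNReal.some_eq_coe, -ENNReal.some_eq_coe']

variable {ϑ : Ω → ℝ≥0} {r p : ℝ} {φ ψ v : State d → ℝ≥0}

theorem measurable_ext {f : State d → ℝ≥0} (hf : Measurable f) : Measurable (ext f) :=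
  hf.coe_nnreal_ennreal

theorem measurable_exp_neg_mul (r : ℝ) :
    Measurable fun t : ℝ≥0 => ENNReal.ofReal (Real.exp (-r * t)) := by
  fun_prop

theorem measurable_reward (p : ℝ) (hψ : Measurable ψ) (hv : Measurable v) :
    Measurable fun y => ENNReal.ofReal p * ext ψ y + ENNReal.ofReal (1 - p) * ext v y :=
  ((measurable_ext hψ).const_mul _).add ((measurable_ext hv).const_mul _)

theorem measurable_Lam [IsProbabilityMeasure P] (hX : IsStrongMarkovFlow P 𝓕 X) (ϑ : Ω → ℝ≥0)
    (r p : ℝ) (hψ : Measurable ψ) (hv : Measurable v) : Measurable (Lam P X ϑ r p ψ v) :=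
  Measurable.lintegral_prod_left'
    (((measurable_exp_neg_mul r).comp measurable_fst).mul
      (hX.measurable_lintegral_apply (measurable_reward p hψ hv)))

/-- The continuation payoff after the independent delay may be replaced by `Λ v` at `X_τ`. -/
theorem payoff₁_eq_lintegral_Lam [IsProbabilityMeasure P] (h𝓕 : UsualConditions P 𝓕)
    (hX : IsStrongMarkovFlow P 𝓕 X) (hϑ : Measurable ϑ)
    (hindep : Indep (MeasurableSpace.comap ϑ inferInstance) (⨆ t, 𝓕 t) P)
    (hφ : Measurable φ) (hψ : Measurable ψ) (hv : Measurable v) (x : State d) {α : Ω → Fin 2}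
    (h : Admissible 𝓕 τ α) :
    payoff₁ P X ϑ r p φ ψ v x τ α =
      ∫⁻ ω, ((if α ω = 0 then discount r (τ ω) * evalAt X (ext φ) x ω (τ ω) else 0) +
        (if α ω = 1 then discount r (τ ω) * evalAt X (Lam P X ϑ r p ψ v) x ω (τ ω) else 0)) ∂P := by
  obtain ⟨hτ, hα⟩ := h
  have hD : Measurable[hτ.measurableSpace] fun ω => discount r (τ ω) :=
    (measurable_discount r).comp hτ.measurable
  have hα' : ∀ i, MeasurableSet[hτ.measurableSpace] {ω | α ω = i} := fun i =>
    hα (measurableSet_singleton i)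
  have hfirst : Measurable fun ω =>
      if α ω = 0 then discount r (τ ω) * evalAt X (ext φ) x ω (τ ω) else 0 :=
    Measurable.ite (hτ.measurableSpace_le _ (hα' 0))
      ((hD.mono hτ.measurableSpace_le le_rfl).mul
        ((measurable_evalAt h𝓕 hX hτ x (measurable_ext hφ)).mono hτ.measurableSpace_le le_rfl))
      measurable_const
  rw [payoff₁, lintegral_add_left hfirst, lintegral_add_left hfirst]
  congr 1
  -- The weight is `𝓕_τ`-measurable and zero at `τ = ∞`, so the upper limits at infinity never enter
  -- the continuation term.
  let w : Ω → ℝ≥0∞ := fun ω => if α ω = 1 then discount r (τ ω) else 0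
  have hw : Measurable[hτ.measurableSpace] w :=
    @Measurable.ite _ _ _ _ hτ.measurableSpace _ _ _ (hα' 1) hD
      (@measurable_const _ _ _ hτ.measurableSpace _)
  have key := hX.lintegral_mul_shift_of_indep hϑ hindep hτ x hw
    (fun ω hω => by simp [w, hω]) (measurable_exp_neg_mul r) (measurable_reward p hψ hv)
  have hterm : ∀ (ω : Ω) (A B : ℝ≥0∞),
      (τ ω ≠ ⊤ → A = discount r (τ ω) * B) → (τ ω = ⊤ → A = 0) →
        (if α ω = 1 then A else 0) = w ω * B := by
    intro ω A B hfin htop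
    by_cases hω : τ ω = ⊤
    · simp [w, hω, htop hω]
    · by_cases h1 : α ω = 1 <;> simp [w, h1, hfin hω]
  refine Eq.trans (lintegral_congr fun ω => ?_) (key.trans (lintegral_congr fun ω => ?_))
  · refine hterm ω _ _ (fun hω => ?_) (fun hω => by rw [hω, WithTop.top_add, discount_top, zero_mul])
    lift τ ω to ℝ≥0 using hω with t
    rw [discount_coe_add, mul_assoc]
    rfl
  · refine (hterm ω _ _ (fun hω => ?_) (fun hω => by simp [hω])).symm
    lift τ ω to ℝ≥0 using hω with t
    rfl

theorem payoff₁_le_payoff₂ [IsProbabilityMeasure P] (h𝓕 : UsualConditions P 𝓕)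
    (hX : IsStrongMarkovFlow P 𝓕 X) (hϑ : Measurable ϑ)
    (hindep : Indep (MeasurableSpace.comap ϑ inferInstance) (⨆ t, 𝓕 t) P)
    (hφ : Measurable φ) (hψ : Measurable ψ) (hv : Measurable v) (x : State d) {α : Ω → Fin 2}
    (h : Admissible 𝓕 τ α) :
    payoff₁ P X ϑ r p φ ψ v x τ α ≤ payoff₂ P X ϑ r p φ ψ v x τ := by
  rw [payoff₁_eq_lintegral_Lam h𝓕 hX hϑ hindep hφ hψ hv x h]
  refine lintegral_mono fun ω => ?_
  rcases Fin.exists_fin_two.1 ⟨α ω, rfl⟩ with h0 | h1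
  · simp only [h0, if_true, Fin.zero_eq_one_iff, OfNat.ofNat_ne_one, if_false, add_zero]
    gcongr
    exact le_max_left _ _
  · simp only [h1, if_true, Fin.one_eq_zero_iff, OfNat.ofNat_ne_one, if_false, zero_add]
    gcongr
    exact le_max_right _ _

theorem admissible_alphaStar [IsProbabilityMeasure P] (h𝓕 : UsualConditions P 𝓕)
    (hX : IsStrongMarkovFlow P 𝓕 X) (ϑ : Ω → ℝ≥0) (r p : ℝ) (hφ : Measurable φ)
    (hψ : Measurable ψ) (hv : Measurable v) (x : State d) (hτ : IsStoppingTime 𝓕 τ) :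
    Admissible 𝓕 τ (alphaStar P X ϑ r p φ ψ v x τ) := by
  refine ⟨hτ, @Measurable.ite _ _ _ _ hτ.measurableSpace _ _ _ ?_
    (@measurable_const _ _ _ hτ.measurableSpace _) (@measurable_const _ _ _ hτ.measurableSpace _)⟩
  exact @measurableSet_lt _ _ _ _ _ hτ.measurableSpace _ _ _ _ _
    (measurable_evalAt h𝓕 hX hτ x (measurable_ext hφ))
    (measurable_evalAt h𝓕 hX hτ x (measurable_Lam hX ϑ r p hψ hv))

/-- The control selects the larger reward on each path; in a tie it takes `φ`, which changes
nothing. -/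
theorem payoff₁_alphaStar [IsProbabilityMeasure P] (h𝓕 : UsualConditions P 𝓕)
    (hX : IsStrongMarkovFlow P 𝓕 X) (hϑ : Measurable ϑ)
    (hindep : Indep (MeasurableSpace.comap ϑ inferInstance) (⨆ t, 𝓕 t) P)
    (hφ : Measurable φ) (hψ : Measurable ψ) (hv : Measurable v) (x : State d)
    (hτ : IsStoppingTime 𝓕 τ) :
    payoff₁ P X ϑ r p φ ψ v x τ (alphaStar P X ϑ r p φ ψ v x τ) =
      payoff₂ P X ϑ r p φ ψ v x τ := by
  rw [payoff₁_eq_lintegral_Lam h𝓕 hX hϑ hindep hφ hψ hv x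
    (admissible_alphaStar h𝓕 hX ϑ r p hφ hψ hv x hτ)]
  refine lintegral_congr fun ω => ?_
  by_cases h : evalAt X (Lam P X ϑ r p ψ v) x ω (τ ω) > evalAt X (ext φ) x ω (τ ω)
  · simp [alphaStar, h, max_eq_right h.le]
  · simp [alphaStar, h, max_eq_left (not_lt.1 h)]

theorem value₁_eq_value₂ [IsProbabilityMeasure P] (h𝓕 : UsualConditions P 𝓕)
    (hX : IsStrongMarkovFlow P 𝓕 X) (hϑ : Measurable ϑ)
    (hindep : Indep (MeasurableSpace.comap ϑ inferInstance) (⨆ t, 𝓕 t) P)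
    (hφ : Measurable φ) (hψ : Measurable ψ) (hv : Measurable v) (x : State d) :
    value₁ P 𝓕 X ϑ r p φ ψ v x = value₂ P 𝓕 X ϑ r p φ ψ v x := by
  refine le_antisymm (iSup_le fun τ => iSup₂_le fun α h => ?_) (iSup₂_le fun τ hτ => ?_)
  · exact (payoff₁_le_payoff₂ h𝓕 hX hϑ hindep hφ hψ hv x h).trans
      (le_iSup₂_of_le τ h.1 le_rfl)
  · rw [← payoff₁_alphaStar h𝓕 hX hϑ hindep hφ hψ hv x hτ]
    exact le_iSup_of_le τ (le_iSup₂_of_le _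
      (admissible_alphaStar h𝓕 hX ϑ r p hφ hψ hv x hτ) le_rfl)

end Payoff

end RecursiveStopping

theorem lemma2p4 {Ω : Type*} [m : MeasurableSpace Ω] {d : ℕ}
    (P : Measure Ω) [IsProbabilityMeasure P]
    (𝓕 : Filtration ℝ≥0 m) (h𝓕 : RecursiveStopping.UsualConditions P 𝓕)
    (X : ℝ≥0 → RecursiveStopping.State d → Ω → RecursiveStopping.State d)
    (hX : RecursiveStopping.IsStrongMarkovFlow P 𝓕 X)
    (ϑ : Ω → ℝ≥0) (hϑ : Measurable ϑ)
    (hindep : Indep (MeasurableSpace.comap ϑ inferInstance) (⨆ t, 𝓕 t) P)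
    (r : ℝ) (hr : 0 < r) (p : ℝ) (hp₀ : 0 < p) (hp₁ : p < 1)
    (φ ψ : RecursiveStopping.State d → ℝ≥0) (hφ : Measurable φ) (hψ : Measurable ψ)
    (hφψ : ∀ x, φ x ≤ ψ x) :
    (∀ v : RecursiveStopping.State d → ℝ≥0,
      RecursiveStopping.SolvesProblem₁ P 𝓕 X ϑ r p φ ψ v ↔
        RecursiveStopping.SolvesProblem₂ P 𝓕 X ϑ r p φ ψ v) ∧
    (∀ v : RecursiveStopping.State d → ℝ≥0,
      RecursiveStopping.SolvesProblem₂ P 𝓕 X ϑ r p φ ψ v →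
      ∀ (x : RecursiveStopping.State d) (τ : Ω → WithTop ℝ≥0),
        RecursiveStopping.IsOptimalTime P 𝓕 X ϑ r p φ ψ v x τ →
        RecursiveStopping.IsOptimalPair P 𝓕 X ϑ r p φ ψ v x τ
          (RecursiveStopping.alphaStar P X ϑ r p φ ψ v x τ)) := by
  have hvalue : ∀ v : RecursiveStopping.State d → ℝ≥0, Continuous v → ∀ x,
      RecursiveStopping.value₁ P 𝓕 X ϑ r p φ ψ v x =
        RecursiveStopping.value₂ P 𝓕 X ϑ r p φ ψ v x := fun v hv x =>
    RecursiveStopping.value₁_eq_value₂ h𝓕 hX hϑ hindep hφ hψ hv.measurable x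
  refine ⟨fun v => and_congr_right fun hv => forall_congr' fun x => by rw [hvalue v hv x], ?_⟩
  rintro v ⟨hv, -⟩ x τ ⟨hτ, hopt⟩
  refine ⟨RecursiveStopping.admissible_alphaStar h𝓕 hX ϑ r p hφ hψ hv.measurable x hτ, ?_⟩
  rw [RecursiveStopping.payoff₁_alphaStar h𝓕 hX hϑ hindep hφ hψ hv.measurable x hτ, hopt,
    hvalue v hv x]
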